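/- Let $E$ be a CW complex, $n\ge 0$ an integer, $\mathcal{E}_n$ the set of $n$-cells of $E$, $G$ a finite abelian group and $\hat G$ its group of characters $\chi:G\to\mathbb{C}^\times$ (written additively). Put the Hilbert space $\ell^2(G)$ on each $n$-cell. For a finite $\Lambda\subseteq\mathcal{E}_n$ let $\mathfrak{A}_\Lambda=B(\ell^2(G)^{\otimes\Lambda})$, and let $\mathfrak{A}$ be the quasi-local algebra, i.e. the C*-algebraic direct limit of the $\mathfrak{A}_\Lambda$ along the inclusions $\mathfrak{A}_\Lambda\hookrightarrow\mathfrak{A}_{\Lambda'}$, $A\mapsto A\otimes\mathrm{id}$, for $\Lambda\subseteq\Lambda'$. On $\ell^2(G)$ let $X^g|h\rangle=|g+h\rangle$ and $Z^\chi|h\rangle=\chi(h)|h\rangle$. For finitely supported families $a=(g_\alpha)_{\alpha\in\mathcal{E}_n}$ in $G$ and $b=(\chi_\alpha)_{\alpha\in\mathcal{E}_n}$ in $\hat G$ let $X^a=\prod_\alpha (X^{g_\alpha})_\alpha$ and $Z^b=\prod_\alpha(Z^{\chi_\alpha})_\alpha$ in $\mathfrak{A}$, where $(\cdot)_\alpha$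 denotes the operator acting at the site $\alpha$. For a locally finite chain $\gamma=(\chi_\alpha)_\alpha\in\prod_{\alpha\in\mathcal{E}_n}\hat G$, a cochain $\delta=(g_\alpha)_\alpha\in\prod_{\alpha\in\mathcal{E}_n}G$ and a finite $K\subseteq\mathcal{E}_n$, let $\gamma_K$ and $\delta_K$ be the families that agree with $\gamma$, resp. $\delta$, on $K$ and vanish outside $K$. Then: 1. For all $A\in\mathfrak{A}$ the limits $$\rho_\gamma(A)=\lim_{K\to\mathcal{E}_n}Z^{\gamma_K}AZ^{-\gamma_K},\qquad \rho_\delta(A)=\lim_{K\to\mathcal{E}_n}X^{\delta_K}AX^{-\delta_K}$$ over the finite subsets $K\subseteq\mathcal{E}_n$ directed by inclusion exist in norm. 2. $\rho_\gamma$ and $\rho_\delta$ are ($*$-)automorphisms of $\mathfrak{A}$. 3. $\rho_\gamma$ is inner (of the form $A\mapsto UAU^*$ with $U\in\mathfrak{A}$ unitary) if and only if $\gamma$ has finite support, and $\rho_\delta$ is inner if and only if $\delta$ has finite support. 4. The map $(\gamma,\delta)\mapsto\rho_\gamma\circ\rho_\delta$ is a group homomorphism from $\prod_{\alpha\in\mathcal{E}_n}\hat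 G\times\prod_{\alpha\in\mathcal{E}_n}G$ to the automorphism group of $\mathfrak{A}$. In particular, $\rho_\gamma$ and $\rho_\delta$ commute. -/

import Mathlib

open Filter Topology

namespace KitaevCW

noncomputable section

open scoped Kronecker Classical

variable (G : Type*) [Fintype G] {S : Type*}

/-! ### Local Hilbert spaces and local algebras

The Hilbert space at each site is `ℓ²(G)`. For a finite set `Λ` of sites, the tensor product of the
site spaces is `ℓ²(G^Λ)`: the basis vector `|h⟩`, `h : Λ → G`, is the tensor product of the `|h α⟩`.
-/

/-- The Hilbert space `ℋ_Λ = ℓ²(G)^{⊗Λ} = ℓ²(G^Λ)` of a finite set `Λ` of sites. -/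
abbrev LocalSpace (Λ : Finset S) : Type _ := EuclideanSpace ℂ (Λ → G)

/-- The local algebra `𝔄_Λ = B(ℋ_Λ)`. -/
def LocalAlg (Λ : Finset S) : Type _ := LocalSpace G Λ →L[ℂ] LocalSpace G Λ

instance instCStarAlgebraLocalAlg (Λ : Finset S) : CStarAlgebra (LocalAlg G Λ) :=
  inferInstanceAs (CStarAlgebra (LocalSpace G Λ →L[ℂ] LocalSpace G Λ))

variable {G}

/-- The operator with a given matrix with respect to the basis `|h⟩`, `h : Λ → G`. -/
def ofMatrix (Λ : Finset S) : Matrix (Λ → G) (Λ → G) ℂ ≃⋆ₐ[ℂ] LocalAlg G Λ :=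
  Matrix.toEuclideanCLM (n := Λ → G) (𝕜 := ℂ)

/-- For `Λ ⊆ Λ'`, configurations on `Λ'` are pairs of a configuration on `Λ` and one on `Λ' \ Λ`;
this is the identification `ℋ_Λ' = ℋ_Λ ⊗ ℋ_{Λ' \ Λ}` on basis vectors. -/
def splitConfig {Λ Λ' : Finset S} (hΛ : Λ ≤ Λ') :
    (Λ' → G) ≃ (Λ → G) × ({α : Λ' // (α : S) ∉ Λ} → G) where
  toFun h := (fun α => h ⟨α, hΛ α.2⟩, fun β => h β.1)
  invFun p := fun β => if hb : (β : S) ∈ Λ then p.1 ⟨β, hb⟩ else p.2 ⟨β, hb⟩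
  left_inv h := by
    funext β
    by_cases hb : (β : S) ∈ Λ <;> simp [hb]
  right_inv p := by
    refine Prod.ext ?_ ?_
    · funext α
      simp
    · funext β
      simp [β.2]

/-- The matrix of `A ⊗ id_{Λ' \ Λ}`, for a matrix `A` over the configurations on `Λ ⊆ Λ'`. -/
def inclMatrix {Λ Λ' : Finset S} (hΛ : Λ ≤ Λ') :
    Matrix (Λ → G) (Λ → G) ℂ →⋆ₐ[ℂ] Matrix (Λ' → G) (Λ' → G) ℂ where
  toFun A := (A ⊗ₖ (1 : Matrix ({α : Λ' // (α : S) ∉ Λ} → G) _ ℂ)).submatrix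
    (splitConfig hΛ) (splitConfig hΛ)
  map_one' := by simp
  map_mul' A B := by
    rw [Matrix.submatrix_mul_equiv, ← Matrix.mul_kronecker_mul, one_mul]
  map_zero' := by simp
  map_add' A B := by
    rw [Matrix.add_kronecker]; rfl
  commutes' r := by
    simp only [Algebra.algebraMap_eq_smul_one, Matrix.smul_kronecker, Matrix.one_kronecker_one]
    ext h h'
    simp [Matrix.one_apply]
  map_star' A := by
    simp only [Matrix.star_eq_conjTranspose]
    rw [Matrix.conjTranspose_submatrix, Matrix.conjTranspose_kronecker,
      Matrix.conjTranspose_one]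

theorem inclMatrix_apply {Λ Λ' : Finset S} (hΛ : Λ ≤ Λ') (A : Matrix (Λ → G) (Λ → G) ℂ)
    (h h' : Λ' → G) :
    inclMatrix hΛ A h h' = if ∀ β : Λ', (β : S) ∉ Λ → h β = h' β
      then A (fun α => h ⟨α, hΛ α.2⟩) (fun α => h' ⟨α, hΛ α.2⟩) else 0 := by
  change A _ _ * (1 : Matrix ({α : Λ' // (α : S) ∉ Λ} → G) _ ℂ) _ _ = _
  rw [Matrix.one_apply]
  have : ((splitConfig hΛ h).2 = (splitConfig hΛ h').2) ↔
      ∀ β : Λ', (β : S) ∉ Λ → h β = h' β := by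
    simp [splitConfig, funext_iff]
  simp only [this, mul_ite, mul_one, mul_zero]
  rfl

/-- The inclusion `𝔄_Λ → 𝔄_Λ'`, `A ↦ A ⊗ id`, for `Λ ⊆ Λ'`. -/
def incl (Λ Λ' : Finset S) (hΛ : Λ ≤ Λ') : LocalAlg G Λ →⋆ₐ[ℂ] LocalAlg G Λ' :=
  ((ofMatrix Λ').toStarAlgHom.comp (inclMatrix hΛ)).comp (ofMatrix Λ).symm.toStarAlgHom

theorem incl_ofMatrix {Λ Λ' : Finset S} (hΛ : Λ ≤ Λ') (A : Matrix (Λ → G) (Λ → G) ℂ) :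
    incl Λ Λ' hΛ (ofMatrix Λ A) = ofMatrix Λ' (inclMatrix hΛ A) := by
  simp [incl]

theorem incl_self (Λ : Finset S) (A : LocalAlg G Λ) : incl Λ Λ le_rfl A = A := by
  obtain ⟨M, rfl⟩ := EquivLike.surjective (ofMatrix Λ) A
  rw [incl_ofMatrix]
  congr 1
  ext h h'
  rw [inclMatrix_apply, if_pos (fun β hb => absurd β.2 hb)]

theorem incl_incl {Λ₁ Λ₂ Λ₃ : Finset S} (h₁₂ : Λ₁ ≤ Λ₂) (h₂₃ : Λ₂ ≤ Λ₃) (A : LocalAlg G Λ₁) :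
    incl Λ₂ Λ₃ h₂₃ (incl Λ₁ Λ₂ h₁₂ A) = incl Λ₁ Λ₃ (h₁₂.trans h₂₃) A := by
  obtain ⟨M, rfl⟩ := EquivLike.surjective (ofMatrix Λ₁) A
  simp only [incl_ofMatrix]
  congr 1
  ext h h'
  simp only [inclMatrix_apply]
  by_cases h1 : ∀ β : Λ₃, (β : S) ∉ Λ₁ → h β = h' β
  · rw [if_pos h1, if_pos (fun β hb => h1 β (fun hc => hb (h₁₂ hc)))]
    have h2 : ∀ β : Λ₂, (β : S) ∉ Λ₁ → h ⟨β, h₂₃ β.2⟩ = h' ⟨β, h₂₃ β.2⟩ :=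
      fun β hb => h1 ⟨β, h₂₃ β.2⟩ hb
    exact if_pos h2
  · rw [if_neg h1]
    split_ifs with h2 h3
    · refine absurd (fun β hb => ?_) h1
      by_cases hβ : (β : S) ∈ Λ₂
      · exact h3 ⟨β, hβ⟩ hb
      · exact h2 β hβ
    · rfl
    · rfl

instance instDirectedSystem :
    DirectedSystem (fun Λ : Finset S => LocalAlg G Λ) (incl (G := G) · · ·) where
  map_self Λ A := incl_self Λ A
  map_map _ _ _ h₁₂ h₂₃ A := incl_incl h₁₂ h₂₃ A

/-! ### Local observables: the algebraic direct limit of the local algebras -/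

variable (G S)

/-- The *-algebra of local observables: the algebraic direct limit of the local algebras. -/
def LocalObs : Type _ := DirectLimit (fun Λ : Finset S => LocalAlg G Λ) (incl (G := G) · · ·)

instance instRingLocalObs : Ring (LocalObs G S) :=
  inferInstanceAs (Ring (DirectLimit (fun Λ : Finset S => LocalAlg G Λ) (incl (G := G) · · ·)))

instance instStarRingLocalObs : StarRing (LocalObs G S) :=
  inferInstanceAs (StarRing (DirectLimit (fun Λ : Finset S => LocalAlg G Λ) (incl (G := G) · · ·)))

instance instAlgebraLocalObs : Algebra ℂ (LocalObs G S) :=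
  inferInstanceAs
    (Algebra ℂ (DirectLimit (fun Λ : Finset S => LocalAlg G Λ) (incl (G := G) · · ·)))

instance instStarModuleLocalObs : StarModule ℂ (LocalObs G S) :=
  inferInstanceAs
    (StarModule ℂ (DirectLimit (fun Λ : Finset S => LocalAlg G Λ) (incl (G := G) · · ·)))

variable {S}

/-- The canonical *-homomorphism from `𝔄_Λ` to the algebra of local observables. -/
def toLocalObs (Λ : Finset S) : LocalAlg G Λ →⋆ₐ[ℂ] LocalObs G S :=
  { DirectLimit.Algebra.of (R := ℂ) (fun Λ : Finset S => LocalAlg G Λ) (incl (G := G) · · ·) Λ with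
    map_star' := fun _ => rfl }

variable {G}

theorem toLocalObs_incl {Λ Λ' : Finset S} (hΛ : Λ ≤ Λ') (A : LocalAlg G Λ) :
    toLocalObs G Λ' (incl Λ Λ' hΛ A) = toLocalObs G Λ A :=
  DirectLimit.mk_apply Λ Λ' A hΛ

theorem exists_toLocalObs (x : LocalObs G S) :
    ∃ (Λ : Finset S) (A : LocalAlg G Λ), x = toLocalObs G Λ A :=
  DirectLimit.exists_eq_mk (incl (G := G) · · ·) x

theorem exists_toLocalObs₂ (x y : LocalObs G S) :
    ∃ (Λ : Finset S) (A B : LocalAlg G Λ), x = toLocalObs G Λ A ∧ y = toLocalObs G Λ B :=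
  DirectLimit.exists_eq_mk₂ (incl (G := G) · · ·) x y

/-! ### The C*-norm on local observables -/

variable [AddCommGroup G]

theorem incl_injective {Λ Λ' : Finset S} (hΛ : Λ ≤ Λ') :
    Function.Injective (incl (G := G) Λ Λ' hΛ) := by
  rw [injective_iff_map_eq_zero]
  intro A hA
  obtain ⟨M, rfl⟩ := EquivLike.surjective (ofMatrix Λ) A
  rw [incl_ofMatrix, EmbeddingLike.map_eq_zero_iff] at hA
  rw [EmbeddingLike.map_eq_zero_iff]
  ext k k'
  let k₀ : {α : Λ' // (α : S) ∉ Λ} → G := 0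
  have := congrFun (congrFun hA ((splitConfig hΛ).symm (k, k₀))) ((splitConfig hΛ).symm (k', k₀))
  rw [inclMatrix_apply, if_pos] at this
  · simpa [splitConfig] using this
  · intro β hb
    simp [splitConfig, hb]

theorem norm_incl {Λ Λ' : Finset S} (hΛ : Λ ≤ Λ') (A : LocalAlg G Λ) :
    ‖incl Λ Λ' hΛ A‖ = ‖A‖ :=
  NonUnitalStarAlgHom.norm_map (incl Λ Λ' hΛ) (incl_injective hΛ) A

/-- The norm of a local observable is its norm in any local algebra containing it; this is well
defined because the inclusions of local algebras are isometric. -/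
def localNorm (x : LocalObs G S) : ℝ :=
  DirectLimit.lift (incl (G := G) · · ·) (fun (Λ : Finset S) (A : LocalAlg G Λ) => ‖A‖)
    (fun _ _ hΛ A => (norm_incl hΛ A).symm) x

theorem localNorm_toLocalObs (Λ : Finset S) (A : LocalAlg G Λ) :
    localNorm (toLocalObs G Λ A) = ‖A‖ := rfl

instance instNormedRingLocalObs : NormedRing (LocalObs G S) :=
  { AddGroupNorm.toNormedAddCommGroup (E := LocalObs G S)
      { toFun := localNorm
        map_zero' := by
          rw [← map_zero (toLocalObs G (∅ : Finset S)), localNorm_toLocalObs, norm_zero]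
        add_le' := fun x y => by
          obtain ⟨Λ, A, B, rfl, rfl⟩ := exists_toLocalObs₂ x y
          rw [← map_add]
          exact norm_add_le A B
        neg' := fun x => by
          obtain ⟨Λ, A, rfl⟩ := exists_toLocalObs x
          rw [← map_neg]
          exact norm_neg A
        eq_zero_of_map_eq_zero' := fun x hx => by
          obtain ⟨Λ, A, rfl⟩ := exists_toLocalObs x
          have hA : A = 0 := norm_eq_zero.mp hx
          rw [hA, map_zero] },
    instRingLocalObs G S with
    norm_mul_le := fun x y => by
      obtain ⟨Λ, A, B, rfl, rfl⟩ := exists_toLocalObs₂ x y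
      rw [← map_mul]
      exact norm_mul_le A B }

theorem norm_toLocalObs (Λ : Finset S) (A : LocalAlg G Λ) : ‖toLocalObs G Λ A‖ = ‖A‖ := rfl

instance instNormedAlgebraLocalObs : NormedAlgebra ℂ (LocalObs G S) :=
  { instAlgebraLocalObs G S with
    norm_smul_le := fun r x => by
      obtain ⟨Λ, A, rfl⟩ := exists_toLocalObs x
      change ‖r • toLocalObs G Λ A‖ ≤ _
      rw [← map_smul, norm_toLocalObs, norm_toLocalObs]
      exact norm_smul_le r A }

instance instCStarRingLocalObs : CStarRing (LocalObs G S) where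
  norm_mul_self_le x := by
    obtain ⟨Λ, A, rfl⟩ := exists_toLocalObs x
    rw [← map_star, ← map_mul, norm_toLocalObs, norm_toLocalObs]
    exact CStarRing.norm_mul_self_le A

/-! ### The quasi-local algebra -/

variable (G S)

/-- The quasi-local algebra `𝔄`: the direct limit of the `𝔄_Λ` in the category of C*-algebras, that
is, the completion of the algebra of local observables in its C*-norm. -/
def QuasiLocal : Type _ := UniformSpace.Completion (LocalObs G S)

instance instNormedRingQuasiLocal : NormedRing (QuasiLocal G S) :=
  inferInstanceAs (NormedRing (UniformSpace.Completion (LocalObs G S)))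

instance instCompleteSpaceQuasiLocal : CompleteSpace (QuasiLocal G S) :=
  inferInstanceAs (CompleteSpace (UniformSpace.Completion (LocalObs G S)))

instance instNormedAlgebraQuasiLocal : NormedAlgebra ℂ (QuasiLocal G S) :=
  { (inferInstanceAs (Algebra ℂ (UniformSpace.Completion (LocalObs G S))) :
      Algebra ℂ (QuasiLocal G S)) with
    norm_smul_le := fun r x => norm_smul_le (β := UniformSpace.Completion (LocalObs G S)) r x }

instance instStarQuasiLocal : Star (QuasiLocal G S) where
  star := UniformSpace.Completion.map (star : LocalObs G S → LocalObs G S)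

variable {G S}

/-- The canonical map from the local observables to the quasi-local algebra. -/
def ofLocalObs (x : LocalObs G S) : QuasiLocal G S := (x : UniformSpace.Completion (LocalObs G S))

theorem isometry_ofLocalObs : Isometry (ofLocalObs : LocalObs G S → QuasiLocal G S) :=
  UniformSpace.Completion.coe_isometry

theorem denseRange_ofLocalObs : DenseRange (ofLocalObs : LocalObs G S → QuasiLocal G S) :=
  UniformSpace.Completion.denseRange_coe

theorem ofLocalObs_star (x : LocalObs G S) : ofLocalObs (star x) = star (ofLocalObs x) :=
  (UniformSpace.Completion.map_coe star_isometry.uniformContinuous x).symm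

theorem continuous_star_quasiLocal : Continuous (star : QuasiLocal G S → QuasiLocal G S) :=
  UniformSpace.Completion.continuous_map

theorem ofLocalObs_add (x y : LocalObs G S) :
    ofLocalObs (x + y) = ofLocalObs x + ofLocalObs y :=
  UniformSpace.Completion.coe_add x y

theorem ofLocalObs_mul (x y : LocalObs G S) :
    ofLocalObs (x * y) = ofLocalObs x * ofLocalObs y :=
  UniformSpace.Completion.coe_mul x y

theorem ofLocalObs_smul (r : ℂ) (x : LocalObs G S) :
    ofLocalObs (r • x) = r • ofLocalObs x :=
  UniformSpace.Completion.coe_smul r x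

theorem norm_ofLocalObs (x : LocalObs G S) : ‖ofLocalObs x‖ = ‖x‖ :=
  UniformSpace.Completion.norm_coe x

instance instStarRingQuasiLocal : StarRing (QuasiLocal G S) where
  star_involutive x := by
    refine denseRange_ofLocalObs.induction_on (p := fun x => star (star x) = x) x
      (isClosed_eq (continuous_star_quasiLocal.comp continuous_star_quasiLocal) continuous_id) ?_
    intro a
    rw [← ofLocalObs_star, ← ofLocalObs_star, star_star]
  star_mul x y := by
    refine denseRange_ofLocalObs.induction_on₂ (p := fun x y => star (x * y) = star y * star x)
      (isClosed_eq (continuous_star_quasiLocal.comp (continuous_fst.mul continuous_snd))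
        ((continuous_star_quasiLocal.comp continuous_snd).mul
          (continuous_star_quasiLocal.comp continuous_fst))) ?_ x y
    intro a b
    simp only [← ofLocalObs_star, ← ofLocalObs_mul, star_mul]
  star_add x y := by
    refine denseRange_ofLocalObs.induction_on₂ (p := fun x y => star (x + y) = star x + star y)
      (isClosed_eq (continuous_star_quasiLocal.comp (continuous_fst.add continuous_snd))
        ((continuous_star_quasiLocal.comp continuous_fst).add
          (continuous_star_quasiLocal.comp continuous_snd))) ?_ x y
    intro a b
    simp only [← ofLocalObs_star, ← ofLocalObs_add, star_add]

instance instStarModuleQuasiLocal : StarModule ℂ (QuasiLocal G S) where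
  star_smul r x := by
    refine denseRange_ofLocalObs.induction_on (p := fun x => star (r • x) = star r • star x) x
      (isClosed_eq (continuous_star_quasiLocal.comp (continuous_const_smul r))
        (continuous_star_quasiLocal.const_smul (star r))) ?_
    intro a
    simp only [← ofLocalObs_star, ← ofLocalObs_smul, star_smul]

instance instCStarRingQuasiLocal : CStarRing (QuasiLocal G S) where
  norm_mul_self_le x := by
    refine denseRange_ofLocalObs.induction_on (p := fun x => ‖x‖ * ‖x‖ ≤ ‖star x * x‖) x
      (isClosed_le (continuous_norm.mul continuous_norm)
        (continuous_norm.comp (continuous_star_quasiLocal.mul continuous_id))) ?_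
    intro a
    simp only [← ofLocalObs_star, ← ofLocalObs_mul, norm_ofLocalObs]
    exact CStarRing.norm_mul_self_le a

instance instCStarAlgebraQuasiLocal : CStarAlgebra (QuasiLocal G S) where

/-- The canonical *-homomorphism `𝔄_Λ → 𝔄`. -/
def embed (Λ : Finset S) : LocalAlg G Λ →⋆ₐ[ℂ] QuasiLocal G S where
  toFun A := ofLocalObs (toLocalObs G Λ A)
  map_one' := by rw [map_one]; rfl
  map_mul' A B := by rw [map_mul, ofLocalObs_mul]
  map_zero' := by rw [map_zero]; rfl
  map_add' A B := by rw [map_add, ofLocalObs_add]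
  commutes' r := by
    rw [AlgHomClass.commutes, Algebra.algebraMap_eq_smul_one, Algebra.algebraMap_eq_smul_one,
      ofLocalObs_smul]
    rfl
  map_star' A := by rw [map_star, ofLocalObs_star]

theorem embed_incl {Λ Λ' : Finset S} (hΛ : Λ ≤ Λ') (A : LocalAlg G Λ) :
    embed Λ' (incl Λ Λ' hΛ A) = embed Λ A :=
  congrArg ofLocalObs (toLocalObs_incl hΛ A)

theorem norm_embed (Λ : Finset S) (A : LocalAlg G Λ) : ‖embed Λ A‖ = ‖A‖ :=
  norm_ofLocalObs _

theorem dense_iUnion_range_embed :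
    Dense (⋃ Λ : Finset S, Set.range (embed (G := G) Λ)) := by
  refine denseRange_ofLocalObs.mono ?_
  rintro _ ⟨x, rfl⟩
  obtain ⟨Λ, A, rfl⟩ := exists_toLocalObs x
  exact Set.mem_iUnion.mpr ⟨Λ, A, rfl⟩

/-! ### Generalised Pauli operators -/

/-- The matrix of `X^g` on `ℓ²(G)`: `X^g |h⟩ = |g + h⟩`. -/
def pauliX (g : G) : Matrix G G ℂ := Matrix.of fun h' h => if h' = g + h then 1 else 0

/-- The matrix of `Z^χ` on `ℓ²(G)`: `Z^χ |h⟩ = χ(h) |h⟩`, for a character `χ` of `G`. -/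
def pauliZ (χ : AddChar G ℂ) : Matrix G G ℂ := Matrix.diagonal fun h => χ h

/-- The operator `⨂_{α ∈ Λ} A_α` on `ℋ_Λ`, where `A_α` acts at the site `α`: its matrix elements are
the products over `α ∈ Λ` of the matrix elements of the `A_α`. -/
def tensorOp (Λ : Finset S) (A : S → Matrix G G ℂ) : LocalAlg G Λ :=
  ofMatrix Λ (Matrix.of fun h' h => ∏ α : Λ, A α (h' α) (h α))

/-- `Z^b = ∏_α (Z^{χ_α})_α` for a finite chain `b = ∑_α χ_α e_α`; the factors outside the support of
`b` are the identity. -/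
def opZ (b : S →₀ AddChar G ℂ) : QuasiLocal G S :=
  embed b.support (tensorOp b.support fun α => pauliZ (b α))

/-- `X^a = ∏_α (X^{g_α})_α` for a finite cochain `a = ∑_α g_α e_α`; the factors outside the support
of `a` are the identity. -/
def opX (a : S →₀ G) : QuasiLocal G S :=
  embed a.support (tensorOp a.support fun α => pauliX (a α))

/-- The truncation `c_K = ∑_{α ∈ K} c_α e_α` of a possibly infinite (co)chain `c = ∑_α c_α e_α` to a
finite set `K` of cells. -/
def truncate {M : Type*} [Zero M] (c : S → M) (K : Finset S) : S →₀ M :=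
  Finsupp.indicator K fun α _ => c α

/-- `ρ_γ(A) = lim_K Z^{γ_K} A Z^{-γ_K}`, a limit in norm over the finite sets `K` of sites directed by
inclusion. -/
def rhoZ (γ : S → AddChar G ℂ) (A : QuasiLocal G S) : QuasiLocal G S :=
  limUnder atTop fun K : Finset S => opZ (truncate γ K) * A * opZ (-truncate γ K)

/-- `ρ_δ(A) = lim_K X^{δ_K} A X^{-δ_K}`, a limit in norm over the finite sets `K` of sites directed by
inclusion. -/
def rhoX (δ : S → G) (A : QuasiLocal G S) : QuasiLocal G S :=
  limUnder atTop fun K : Finset S => opX (truncate δ K) * A * opX (-truncate δ K)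

/-- A map of a C*-algebra to itself is an automorphism if it is a bijective *-homomorphism. -/
def IsAutomorphism {A : Type*} [CStarAlgebra A] (ρ : A → A) : Prop :=
  ∃ φ : A ≃⋆ₐ[ℂ] A, ∀ a, φ a = ρ a

/-- A map of a C*-algebra to itself is an inner automorphism if it is `a ↦ u a u*` for some unitary
element `u` of the algebra. -/
def IsInner {A : Type*} [CStarAlgebra A] (ρ : A → A) : Prop :=
  ∃ u ∈ unitary A, ∀ a, ρ a = u * a * star u

end

end KitaevCW

namespace KitaevCW

noncomputable section

open scoped Kronecker Classical

/-! ### Infinite products of commuting automorphisms of a C*-algebra -/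

section InfiniteProduct

variable {S M A : Type*}

/-! The operators `Z^χ X^g` form a projective unitary representation of the finite abelian group `M
= Ĝ × G` on `ℓ²(G)` (`isProjRep_weyl`). Phases cancel under conjugation, so finitely supported
families in `M` act on `𝔄` by a genuine homomorphism, `conjAction`. A family supported off `Λ` fixes
`𝔄_Λ`. Hence on local observables the net of truncations is eventually constant, and since
automorphisms are isometric it converges on all of `𝔄`. The limits again form a homomorphism, now on
all families (`IsLocalAction.exists_extension`). Both `ρ_γ` and `ρ_δ` are values of it, and they
commute because `M` is abelian.

If such a limit is conjugation by `u`, approximate `u` by a local `a`. Observables at sites off the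
support of `a` commute with `a`, so they are almost fixed. But a site with value `m ≠ 0` moves some
one-site matrix by a positive distance depending only on `m` (`exists_not_commute_weyl`). So each of
the finitely many nonzero values occurs at finitely many sites (`isInner_extension_iff`). -/

theorem truncate_apply [Zero M] (c : S → M) (K : Finset S) (α : S) :
    truncate c K α = if α ∈ K then c α else 0 := by
  simp [truncate, Finsupp.indicator_apply]

theorem support_truncate_subset [Zero M] (c : S → M) (K : Finset S) :
    (truncate c K).support ⊆ K := by
  intro α hα
  by_contra h
  simp [truncate_apply, h] at hα

theorem truncate_add [AddCommGroup M] (c c' : S → M) (K : Finset S) :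
    truncate (c + c') K = truncate c K + truncate c' K := by
  ext α
  by_cases h : α ∈ K <;> simp [truncate_apply, h]

theorem truncate_zero [AddCommGroup M] (K : Finset S) : truncate (0 : S → M) K = 0 := by
  ext α
  simp [truncate_apply]

theorem truncate_of_support_subset [Zero M] (c : S → M) {K L : Finset S}
    (hK : ∀ α, c α ≠ 0 → α ∈ K) (hKL : K ⊆ L) : truncate c L = truncate c K := by
  ext α
  simp only [truncate_apply]
  by_cases h : c α = 0
  · simp [h]
  · rw [if_pos (hKL (hK α h)), if_pos (hK α h)]

theorem truncate_eq_add_of_subset [AddCommGroup M] (c : S → M) {K L : Finset S} (hKL : K ⊆ L) :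
    ∃ b : S →₀ M, Disjoint b.support K ∧ truncate c L = truncate c K + b := by
  refine ⟨truncate c L - truncate c K, ?_, by abel⟩
  rw [Finset.disjoint_right]
  intro α hα
  simp [truncate_apply, hα, hKL hα]

variable [AddCommGroup M] [CStarAlgebra A]

/-- A family of automorphisms is local if each element of some dense set is fixed by all
automorphisms supported away from a suitable finite set. -/
def IsLocalAction (φ : Multiplicative (S →₀ M) →* (A ≃⋆ₐ[ℂ] A)) : Prop :=
  Dense {a : A | ∃ Λ : Finset S, ∀ b : S →₀ M, Disjoint b.support Λ →
    φ (Multiplicative.ofAdd b) a = a}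

variable {φ : Multiplicative (S →₀ M) →* (A ≃⋆ₐ[ℂ] A)}

/-- The part of the truncation outside `Λ` acts first and fixes `a`. This gives convergence on the
dense set. -/
theorem apply_truncate_eq_of_subset (c : S → M) {a : A} {Λ K : Finset S}
    (ha : ∀ b : S →₀ M, Disjoint b.support Λ → φ (Multiplicative.ofAdd b) a = a) (hK : Λ ⊆ K) :
    φ (Multiplicative.ofAdd (truncate c K)) a = φ (Multiplicative.ofAdd (truncate c Λ)) a := by
  obtain ⟨b, hb, h⟩ := truncate_eq_add_of_subset c hK
  rw [h, ofAdd_add, map_mul, StarAlgEquiv.mul_apply, ha b hb]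

theorem norm_starAlgEquiv_sub (ψ : A ≃⋆ₐ[ℂ] A) (a b : A) : ‖ψ a - ψ b‖ = ‖a - b‖ := by
  rw [← map_sub, StarAlgEquiv.norm_map]

theorem IsLocalAction.cauchySeq (hφ : IsLocalAction φ) (c : S → M) (a : A) :
    CauchySeq fun K : Finset S => φ (Multiplicative.ofAdd (truncate c K)) a := by
  rw [Metric.cauchySeq_iff']
  intro ε hε
  -- Both error terms equal `dist a d` by isometry, hence the radius `ε / 2`.
  obtain ⟨d, ⟨Λ, hd⟩, had⟩ := hφ.exists_dist_lt a (half_pos hε)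
  refine ⟨Λ, fun K hK => ?_⟩
  have h := apply_truncate_eq_of_subset c hd hK
  calc _ ≤ dist (φ (Multiplicative.ofAdd (truncate c K)) a)
          (φ (Multiplicative.ofAdd (truncate c K)) d) +
        dist (φ (Multiplicative.ofAdd (truncate c K)) d)
          (φ (Multiplicative.ofAdd (truncate c Λ)) a) := dist_triangle _ _ _
    _ = dist a d + dist d a := by
      congr 1
      · simp only [dist_eq_norm, norm_starAlgEquiv_sub]
      · rw [h]
        simp only [dist_eq_norm, norm_starAlgEquiv_sub]
    _ < ε := by
      rw [dist_comm d a]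
      linarith

/-- Isometries are equicontinuous: `ψ i (x i)` and `ψ i a` are as far apart as `x i` and `a`. -/
theorem tendsto_apply_of_tendsto {ι : Type*} {l : Filter ι} (ψ : ι → A ≃⋆ₐ[ℂ] A) {x : ι → A}
    {a b : A} (hx : Tendsto x l (𝓝 a)) (hψ : Tendsto (fun i => ψ i a) l (𝓝 b)) :
    Tendsto (fun i => ψ i (x i)) l (𝓝 b) := by
  refine hψ.congr_dist ?_
  simp only [dist_eq_norm, norm_starAlgEquiv_sub]
  simpa only [dist_eq_norm, dist_comm a] using
    (tendsto_iff_dist_tendsto_zero.mp hx).congr fun i => dist_comm _ _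

theorem IsLocalAction.exists_extension (hφ : IsLocalAction φ) :
    ∃ Φ : Multiplicative (S → M) →* (A ≃⋆ₐ[ℂ] A), ∀ (c : S → M) (a : A),
      Tendsto (fun K : Finset S => φ (Multiplicative.ofAdd (truncate c K)) a) atTop
        (𝓝 (Φ (Multiplicative.ofAdd c) a)) := by
  choose F hF using fun c a => cauchySeq_tendsto_of_complete (hφ.cauchySeq c a)
  have hzero (a : A) : F 0 a = a := by
    refine tendsto_nhds_unique (hF 0 a) ?_
    simp only [truncate_zero, ofAdd_zero, map_one, StarAlgEquiv.one_apply]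
    exact tendsto_const_nhds
  -- Both factors are truncated at the same `K`, so the argument of the outer one varies with `K` as
  -- well.
  have hadd (c c' : S → M) (a : A) : F (c + c') a = F c (F c' a) := by
    refine tendsto_nhds_unique (hF (c + c') a) ?_
    simp only [truncate_add, ofAdd_add, map_mul, StarAlgEquiv.mul_apply]
    exact tendsto_apply_of_tendsto _ (hF c' a) (hF c _)
  let Φ₀ (c : S → M) : A ≃⋆ₐ[ℂ] A :=
    { toFun := F c
      invFun := F (-c)
      left_inv := fun a => by rw [← hadd, neg_add_cancel, hzero]
      right_inv := fun a => by rw [← hadd, add_neg_cancel, hzero]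
      map_mul' := fun a b => tendsto_nhds_unique (hF c _) <| by
        simpa only [map_mul] using (hF c a).mul (hF c b)
      map_add' := fun a b => tendsto_nhds_unique (hF c _) <| by
        simpa only [map_add] using (hF c a).add (hF c b)
      map_star' := fun a => tendsto_nhds_unique (hF c _) <| by
        simpa only [map_star] using (hF c a).star
      map_smul' := fun r a => tendsto_nhds_unique (hF c _) <| by
        simpa only [map_smul] using (hF c a).const_smul r }
  exact ⟨{ toFun := fun c => Φ₀ c.toAdd
           map_one' := StarAlgEquiv.ext hzero
           map_mul' := fun c c' => StarAlgEquiv.ext (hadd c.toAdd c'.toAdd) }, hF⟩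

end InfiniteProduct

/-! ### Tensor products of matrices -/

section TensorMatrix

variable {G ι : Type*} [Fintype ι]

/-- The matrix of `⨂_i A_i` on configurations `ι → G`. -/
def tensorMatrix (A : ι → Matrix G G ℂ) : Matrix (ι → G) (ι → G) ℂ :=
  Matrix.of fun h' h => ∏ i, A i (h' i) (h i)

theorem tensorMatrix_apply (A : ι → Matrix G G ℂ) (h' h : ι → G) :
    tensorMatrix A h' h = ∏ i, A i (h' i) (h i) := rfl

theorem tensorMatrix_one [DecidableEq ι] : tensorMatrix (fun _ : ι => (1 : Matrix G G ℂ)) = 1 := by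
  ext h' h
  simp [tensorMatrix_apply, Matrix.one_apply, Fintype.prod_ite_zero, funext_iff]

theorem tensorMatrix_mul [Fintype G] [DecidableEq ι] (A B : ι → Matrix G G ℂ) :
    tensorMatrix (fun i => A i * B i) = tensorMatrix A * tensorMatrix B := by
  ext h' h
  simp only [tensorMatrix_apply, Matrix.mul_apply, ← Finset.prod_mul_distrib]
  -- Distributivity: a product over sites of sums over `G` is a sum over configurations.
  rw [Finset.prod_univ_sum, Fintype.piFinset_univ]

theorem tensorMatrix_star (A : ι → Matrix G G ℂ) :
    tensorMatrix (fun i => star (A i)) = star (tensorMatrix A) := by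
  ext h' h
  simp [tensorMatrix_apply, Matrix.star_apply]

theorem tensorMatrix_smul (c : ι → ℂ) (A : ι → Matrix G G ℂ) :
    tensorMatrix (fun i => c i • A i) = (∏ i, c i) • tensorMatrix A := by
  ext h' h
  simp [tensorMatrix_apply, Finset.prod_mul_distrib]

end TensorMatrix

/-! ### Tensor product operators and locality -/

section TensorOp

variable {G S : Type*}

theorem tensorMatrix_split {Λ Λ' : Finset S} (hΛ : Λ ≤ Λ') (A : S → Matrix G G ℂ) :
    tensorMatrix (fun α : Λ' => A α) =
      (tensorMatrix (fun α : Λ => A α) ⊗ₖ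
        tensorMatrix (fun α : {α : Λ' // (α : S) ∉ Λ} => A α)).submatrix
        (splitConfig hΛ) (splitConfig hΛ) := by
  ext h' h
  let e : Λ ≃ {α : Λ' // (α : S) ∈ Λ} :=
    { toFun := fun α => ⟨⟨α, hΛ α.2⟩, α.2⟩
      invFun := fun α => ⟨α.1, α.2⟩
      left_inv := fun _ => rfl
      right_inv := fun _ => rfl }
  simp only [Matrix.submatrix_apply, Matrix.kroneckerMap_apply, tensorMatrix_apply]
  rw [← Fintype.prod_subtype_mul_prod_subtype (fun α : Λ' => (α : S) ∈ Λ), ← e.prod_comp]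
  rfl

variable [Fintype G]

theorem tensorOp_eq (Λ : Finset S) (A : S → Matrix G G ℂ) :
    tensorOp Λ A = ofMatrix Λ (tensorMatrix fun α : Λ => A α) := rfl

theorem tensorOp_congr {Λ : Finset S} {A B : S → Matrix G G ℂ} (h : ∀ α ∈ Λ, A α = B α) :
    tensorOp Λ A = tensorOp Λ B := by
  rw [tensorOp_eq, tensorOp_eq]
  congr 2
  exact funext fun α => h α α.2

theorem tensorOp_one (Λ : Finset S) : tensorOp Λ (fun _ => (1 : Matrix G G ℂ)) = 1 := by
  rw [tensorOp_eq, tensorMatrix_one, map_one]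

theorem tensorOp_mul (Λ : Finset S) (A B : S → Matrix G G ℂ) :
    tensorOp Λ (fun α => A α * B α) = tensorOp Λ A * tensorOp Λ B := by
  rw [tensorOp_eq, tensorMatrix_mul]
  exact map_mul (ofMatrix Λ) _ _

theorem tensorOp_star (Λ : Finset S) (A : S → Matrix G G ℂ) :
    tensorOp Λ (fun α => star (A α)) = star (tensorOp Λ A) := by
  simp only [tensorOp_eq, tensorMatrix_star, map_star]

theorem tensorOp_smul (Λ : Finset S) (c : S → ℂ) (A : S → Matrix G G ℂ) :
    tensorOp Λ (fun α => c α • A α) = (∏ α : Λ, c α) • tensorOp Λ A := by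
  rw [tensorOp_eq, tensorMatrix_smul, map_smul, tensorOp_eq]

theorem incl_tensorOp {Λ Λ' : Finset S} (hΛ : Λ ≤ Λ') {A : S → Matrix G G ℂ}
    (hA : ∀ α ∈ Λ', α ∉ Λ → A α = 1) : incl Λ Λ' hΛ (tensorOp Λ A) = tensorOp Λ' A := by
  rw [tensorOp_eq, tensorOp_eq, incl_ofMatrix, tensorMatrix_split hΛ]
  have h : (fun α : {α : Λ' // (α : S) ∉ Λ} => A α) = fun _ => 1 :=
    funext fun α => hA α α.1.2 α.2
  rw [h, tensorMatrix_one]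
  rfl

/-- In the splitting of `Λ'` into `Λ` and its complement, the two operators are `1 ⊗ W` and `M ⊗ 1`.
-/
theorem commute_incl_tensorOp {Λ Λ' : Finset S} (hΛ : Λ ≤ Λ') {V : S → Matrix G G ℂ}
    (hV : ∀ α ∈ Λ, V α = 1) (A : LocalAlg G Λ) :
    Commute (tensorOp Λ' V) (incl Λ Λ' hΛ A) := by
  obtain ⟨M, rfl⟩ := EquivLike.surjective (ofMatrix Λ) A
  rw [incl_ofMatrix, tensorOp_eq]
  refine Commute.map (f := ofMatrix Λ') ?_
  have h : (fun α : Λ => V α) = fun _ => 1 := funext fun α => hV α α.2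
  rw [tensorMatrix_split hΛ, h, tensorMatrix_one]
  change _ * (M ⊗ₖ 1).submatrix (splitConfig hΛ) (splitConfig hΛ) =
    (M ⊗ₖ 1).submatrix (splitConfig hΛ) (splitConfig hΛ) * _
  simp only [Matrix.submatrix_mul_equiv, ← Matrix.mul_kronecker_mul, one_mul, mul_one]

variable [AddCommGroup G]

theorem embed_tensorOp_of_subset {Λ Λ' : Finset S} (hΛ : Λ ≤ Λ') {A : S → Matrix G G ℂ}
    (hA : ∀ α ∈ Λ', α ∉ Λ → A α = 1) : embed Λ (tensorOp Λ A) = embed Λ' (tensorOp Λ' A) := by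
  rw [← embed_incl hΛ, incl_tensorOp hΛ hA]

theorem commute_embed_tensorOp {Λ Λ' : Finset S} {V : S → Matrix G G ℂ}
    (hV : ∀ α, α ∉ Λ' → V α = 1) (hdisj : Disjoint Λ' Λ) (A : LocalAlg G Λ) :
    Commute (embed Λ' (tensorOp Λ' V)) (embed Λ A) := by
  have h₁ : Λ' ≤ Λ ∪ Λ' := Finset.subset_union_right
  have h₂ : Λ ≤ Λ ∪ Λ' := Finset.subset_union_left
  rw [embed_tensorOp_of_subset h₁ fun α _ h => hV α h, ← embed_incl h₂]
  exact (commute_incl_tensorOp h₂ (fun α hα => hV α (Finset.disjoint_right.mp hdisj hα)) A).map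
    (embed (Λ ∪ Λ'))

end TensorOp

/-! ### One-site observables -/

section OneSite

open scoped Matrix.Norms.L2Operator

variable {G S : Type*} [Fintype G]

theorem tensorOp_singleton_eq_zero {α : S} {B : Matrix G G ℂ}
    (hB : tensorOp {α} (fun _ => B) = 0) : B = 0 := by
  rw [tensorOp_eq, EmbeddingLike.map_eq_zero_iff] at hB
  ext h' h
  simpa [tensorMatrix_apply] using congrFun (congrFun hB fun _ => h') fun _ => h

variable [AddCommGroup G]

/-- The embedding of the matrix algebra of one site into the quasi-local algebra. -/
def siteEmbed (α : S) : Matrix G G ℂ →⋆ₐ[ℂ] QuasiLocal G S where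
  toFun B := embed {α} (tensorOp {α} fun _ => B)
  map_one' := by rw [tensorOp_one, map_one]
  map_mul' A B := by rw [tensorOp_mul, map_mul]
  map_zero' := by
    have h : tensorOp {α} (fun _ => (0 : Matrix G G ℂ)) = 0 := by
      rw [tensorOp_eq, EmbeddingLike.map_eq_zero_iff]
      ext h' h
      simp [tensorMatrix_apply]
    rw [h, map_zero]
  map_add' A B := by
    rw [← map_add, tensorOp_eq, tensorOp_eq, tensorOp_eq, ← map_add]
    congr 2
    ext h' h
    simp [tensorMatrix_apply]
  commutes' r := by
    have h := tensorOp_smul {α} (fun _ => r) (fun _ => (1 : Matrix G G ℂ))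
    rw [tensorOp_one] at h
    rw [Algebra.algebraMap_eq_smul_one, h, map_smul, map_one, Algebra.algebraMap_eq_smul_one]
    simp
  map_star' A := by rw [tensorOp_star, map_star]

theorem siteEmbed_apply (α : S) (B : Matrix G G ℂ) :
    siteEmbed α B = embed {α} (tensorOp {α} fun _ => B) := rfl

/-- The constant family `B` is not trivial off `α`, as `commute_embed_tensorOp` requires; this
family is. -/
theorem siteEmbed_eq (α : S) (B : Matrix G G ℂ) :
    siteEmbed α B = embed {α} (tensorOp {α} fun β => if β = α then B else 1) := by
  rw [siteEmbed_apply]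
  congr 1
  refine tensorOp_congr fun β hβ => ?_
  rw [if_pos (Finset.mem_singleton.mp hβ)]

/-- An injective *-homomorphism of C*-algebras is isometric. Distances between one-site observables
are therefore the same at every site. -/
theorem norm_siteEmbed (α : S) (B : Matrix G G ℂ) : ‖siteEmbed α B‖ = ‖B‖ := by
  refine NonUnitalStarAlgHom.norm_map (siteEmbed α) ?_ B
  rw [injective_iff_map_eq_zero]
  intro B hB
  refine tensorOp_singleton_eq_zero (α := α) ?_
  rw [← norm_eq_zero, ← norm_embed, ← siteEmbed_apply, hB, norm_zero]

theorem commute_siteEmbed {α : S} {Λ : Finset S} (hα : α ∉ Λ) (B : Matrix G G ℂ)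
    (A : LocalAlg G Λ) : Commute (siteEmbed α B) (embed Λ A) := by
  rw [siteEmbed_eq]
  refine commute_embed_tensorOp (fun β hβ => ?_) (Finset.disjoint_singleton_left.mpr hα) A
  rw [if_neg (by simpa using hβ)]

end OneSite

/-! ### Product operators of a projective representation -/

section ProjRep

open scoped Matrix.Norms.L2Operator

variable {G S M : Type*} [Fintype G] [AddCommGroup G] [AddCommGroup M]

/-- A projective unitary representation of `M` on `ℓ²(G)`. -/
structure IsProjRep (V : M → Matrix G G ℂ) : Prop where
  map_zero : V 0 = 1
  mem_unitary (m : M) : V m ∈ unitary (Matrix G G ℂ)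
  map_add (m m' : M) : ∃ c : ℂ, star c * c = 1 ∧ V (m + m') = c • (V m * V m')

/-- The operator `∏_α V(b_α)_α` of a finitely supported family `b`. -/
def productOp (V : M → Matrix G G ℂ) (b : S →₀ M) : QuasiLocal G S :=
  embed b.support (tensorOp b.support fun α => V (b α))

theorem productOp_eq_of_subset {V : M → Matrix G G ℂ} (hV : V 0 = 1) {b : S →₀ M} {Λ : Finset S}
    (hb : b.support ⊆ Λ) : productOp V b = embed Λ (tensorOp Λ fun α => V (b α)) :=
  embed_tensorOp_of_subset hb fun α _ hα => by
    rw [Finsupp.notMem_support_iff.mp hα, hV]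

theorem star_productOp {V : M → Matrix G G ℂ} (hV : V 0 = 1) (hneg : ∀ m, V (-m) = star (V m))
    (b : S →₀ M) : star (productOp V b) = productOp V (-b) := by
  rw [productOp_eq_of_subset hV (Finsupp.support_neg b).le, productOp, ← map_star, ← tensorOp_star]
  simp only [Finsupp.neg_apply, hneg]

variable {V : M → Matrix G G ℂ}

theorem productOp_zero : productOp V (0 : S →₀ M) = 1 := by
  have h : tensorOp (0 : S →₀ M).support (fun α => V ((0 : S →₀ M) α)) =
      tensorOp _ fun _ => (1 : Matrix G G ℂ) := tensorOp_congr fun α hα => by simp at hα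
  rw [productOp, h, tensorOp_one, map_one]

theorem productOp_mem_unitary (hV : IsProjRep V) (b : S →₀ M) :
    productOp V b ∈ unitary (QuasiLocal G S) := by
  rw [Unitary.mem_iff]
  simp only [productOp, ← map_star, ← map_mul, ← tensorOp_star, ← tensorOp_mul,
    Unitary.star_mul_self_of_mem (hV.mem_unitary _), Unitary.mul_star_self_of_mem (hV.mem_unitary _),
    tensorOp_one, map_one, and_self]

theorem exists_productOp_add (hV : IsProjRep V) (b b' : S →₀ M) :
    ∃ c : ℂ, star c * c = 1 ∧ productOp V (b + b') = c • (productOp V b * productOp V b') := by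
  choose c hc h using hV.map_add
  have hb : b.support ⊆ b.support ∪ b'.support := Finset.subset_union_left
  have hb' : b'.support ⊆ b.support ∪ b'.support := Finset.subset_union_right
  refine ⟨∏ α : (b.support ∪ b'.support : Finset S), c (b α) (b' α), ?_, ?_⟩
  · simp only [star_prod, ← Finset.prod_mul_distrib, hc, Finset.prod_const_one]
  -- All three operators are written over the union of the supports, so that the phases can be
  -- collected site by site.
  · rw [productOp_eq_of_subset hV.map_zero hb, productOp_eq_of_subset hV.map_zero hb',
      productOp_eq_of_subset hV.map_zero Finsupp.support_add, ← map_mul, ← tensorOp_mul, ← map_smul,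
      ← tensorOp_smul _ fun α => c (b α) (b' α)]
    simp only [Finsupp.add_apply, h]

/-- Conjugation by the product operators of a projective representation. -/
def conjAction (hV : IsProjRep V) :
    Multiplicative (S →₀ M) →* (QuasiLocal G S ≃⋆ₐ[ℂ] QuasiLocal G S) where
  toFun b := Unitary.conjStarAlgAut ℂ _ ⟨productOp V b.toAdd, productOp_mem_unitary hV _⟩
  map_one' := by
    ext a
    simp [productOp_zero]
  map_mul' b b' := by
    ext a
    -- The phase `c` meets its conjugate in `star` and cancels.
    obtain ⟨c, hc, h⟩ := exists_productOp_add hV b.toAdd b'.toAdd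
    simp only [Unitary.conjStarAlgAut_apply, StarAlgEquiv.mul_apply, toAdd_mul, h, star_smul,
      star_mul, smul_mul_assoc, mul_smul_comm, smul_smul, hc, one_smul, mul_assoc]

theorem conjAction_apply (hV : IsProjRep V) (b : S →₀ M) (a : QuasiLocal G S) :
    conjAction hV (Multiplicative.ofAdd b) a = productOp V b * a * star (productOp V b) := rfl

theorem conjAction_embed (hV : IsProjRep V) {b : S →₀ M} {Λ : Finset S}
    (hb : Disjoint b.support Λ) (A : LocalAlg G Λ) :
    conjAction hV (Multiplicative.ofAdd b) (embed Λ A) = embed Λ A := by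
  have h : Commute (productOp V b) (embed Λ A) :=
    commute_embed_tensorOp (fun α hα => by
      rw [Finsupp.notMem_support_iff.mp hα, hV.map_zero]) hb A
  rw [conjAction_apply, h.eq, mul_assoc, Unitary.mul_star_self_of_mem (productOp_mem_unitary hV b),
    mul_one]

theorem isLocalAction_conjAction (hV : IsProjRep V) :
    IsLocalAction (conjAction (S := S) hV) := by
  refine dense_iUnion_range_embed.mono ?_
  rintro _ ⟨_, ⟨Λ, rfl⟩, A, rfl⟩
  exact ⟨Λ, fun b hb => conjAction_embed hV hb A⟩

/-- The difference is `[u, x] u*`, and `[u, x] = [u - a, x]` because `a` commutes with `x`. -/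
theorem norm_conj_sub_le {A : Type*} [CStarAlgebra A] {u : A} (hu : u ∈ unitary A) {a x : A}
    (h : Commute x a) : ‖u * x * star u - x‖ ≤ 2 * ‖u - a‖ * ‖x‖ := by
  have h₁ : u * x * star u - x = ((u - a) * x - x * (u - a)) * star u := by
    rw [sub_mul u, mul_sub x, h.eq, sub_sub_sub_cancel_right, sub_mul, mul_assoc x,
      Unitary.mul_star_self_of_mem hu, mul_one]
  rw [h₁, CStarRing.norm_mul_mem_unitary _ (Unitary.star_mem hu)]
  calc _ ≤ ‖(u - a) * x‖ + ‖x * (u - a)‖ := norm_sub_le _ _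
    _ ≤ ‖u - a‖ * ‖x‖ + ‖x‖ * ‖u - a‖ := add_le_add (norm_mul_le _ _) (norm_mul_le _ _)
    _ = _ := by ring

variable {Φ : Multiplicative (S → M) →* (QuasiLocal G S ≃⋆ₐ[ℂ] QuasiLocal G S)}

/-- The net is constant from `K = {α}` on, where only the factor at `α` acts. -/
theorem extension_siteEmbed (hV : IsProjRep V)
    (hΦ : ∀ (c : S → M) (a : QuasiLocal G S),
      Tendsto (fun K : Finset S => conjAction hV (Multiplicative.ofAdd (truncate c K)) a) atTop
        (𝓝 (Φ (Multiplicative.ofAdd c) a))) (c : S → M) (α : S) (B : Matrix G G ℂ) :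
    Φ (Multiplicative.ofAdd c) (siteEmbed α B) =
      siteEmbed α (V (c α) * B * star (V (c α))) := by
  have hW : productOp V (truncate c {α}) = siteEmbed α (V (c α)) := by
    rw [productOp_eq_of_subset hV.map_zero (support_truncate_subset c {α}), siteEmbed_apply]
    congr 1
    refine tensorOp_congr fun β hβ => ?_
    rw [truncate_apply, if_pos hβ, Finset.mem_singleton.mp hβ]
  refine tendsto_nhds_unique (hΦ c _) (tendsto_const_nhds.congr' ?_)
  filter_upwards [eventually_ge_atTop ({α} : Finset S)] with K hK
  rw [apply_truncate_eq_of_subset c (a := siteEmbed α B)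
    (fun b hb => conjAction_embed hV hb _) hK, conjAction_apply, hW, map_mul, map_mul, map_star]

theorem isInner_extension_iff [Finite M] (hV : IsProjRep V)
    (hΦ : ∀ (c : S → M) (a : QuasiLocal G S),
      Tendsto (fun K : Finset S => conjAction hV (Multiplicative.ofAdd (truncate c K)) a) atTop
        (𝓝 (Φ (Multiplicative.ofAdd c) a)))
    (hfaithful : ∀ m, m ≠ 0 → ∃ B, V m * B ≠ B * V m) (c : S → M) :
    IsInner (Φ (Multiplicative.ofAdd c)) ↔ {α | c α ≠ 0}.Finite := by
  constructor
  · rintro ⟨u, hu, h⟩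
    have key (m : M) (hm : m ≠ 0) : {α | c α = m}.Finite := by
      obtain ⟨B, hB⟩ := hfaithful m hm
      have hpos : 0 < ‖V m * B * star (V m) - B‖ := by
        refine norm_pos_iff.mpr fun h0 => hB ?_
        conv_rhs => rw [← sub_eq_zero.mp h0]
        rw [mul_assoc, Unitary.star_mul_self_of_mem (hV.mem_unitary m), mul_one]
      have hBpos : 0 < ‖B‖ := by
        refine norm_pos_iff.mpr fun h0 => hB ?_
        rw [h0, mul_zero, zero_mul]
      -- The radius is chosen so that the bound `2 ‖u - a‖ ‖B‖` falls below the displacement of `B`,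
      -- which is the same at all sites with value `m`.
      obtain ⟨_, ⟨_, ⟨Λ, rfl⟩, A, rfl⟩, hA⟩ := dense_iUnion_range_embed.exists_dist_lt u
        (div_pos hpos (mul_pos two_pos hBpos))
      refine Λ.finite_toSet.subset fun α hα => ?_
      by_contra hΛ
      have h₁ := norm_conj_sub_le hu (commute_siteEmbed hΛ B A)
      rw [← h, extension_siteEmbed hV hΦ, show c α = m from hα, ← map_sub, norm_siteEmbed,
        norm_siteEmbed] at h₁
      rw [dist_eq_norm, lt_div_iff₀ (mul_pos two_pos hBpos)] at hA
      linarith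
    -- Finiteness of `M` enters here: the support is a finite union of level sets.
    refine (Set.Finite.biUnion (Set.toFinite {m : M | m ≠ 0}) key).subset fun α hα => ?_
    exact Set.mem_biUnion hα rfl
  · intro hfin
    refine ⟨productOp V (truncate c hfin.toFinset), productOp_mem_unitary hV _, fun a => ?_⟩
    refine tendsto_nhds_unique (hΦ c a) (tendsto_const_nhds.congr' ?_)
    filter_upwards [eventually_ge_atTop hfin.toFinset] with K hK
    rw [truncate_of_support_subset c (fun α hα => hfin.mem_toFinset.mpr hα) hK, conjAction_apply]

end ProjRep

/-! ### Weyl operators -/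

section Weyl

variable {G S : Type*} [AddCommGroup G]

theorem pauliX_zero : pauliX (0 : G) = 1 := by
  ext h' h
  simp [pauliX, Matrix.one_apply]

theorem pauliZ_zero : pauliZ (0 : AddChar G ℂ) = 1 := by
  simp [pauliZ]

theorem pauliX_neg (g : G) : pauliX (-g) = star (pauliX g) := by
  ext h' h
  simp only [pauliX, Matrix.star_apply, Matrix.of_apply, eq_neg_add_iff_add_eq, eq_comm (a := h)]
  split_ifs <;> simp

variable [Fintype G]

/-- The Weyl operator `Z^χ X^g`. -/
def weyl (m : AddChar G ℂ × G) : Matrix G G ℂ := pauliZ m.1 * pauliX m.2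

theorem weyl_apply (m : AddChar G ℂ × G) (h' h : G) :
    weyl m h' h = if h' = m.2 + h then m.1 h' else 0 := by
  simp [weyl, pauliZ, pauliX, Matrix.diagonal_mul]

theorem weyl_mk_zero (χ : AddChar G ℂ) : weyl (χ, 0) = pauliZ χ := by
  rw [weyl, pauliX_zero, mul_one]

theorem weyl_zero_mk (g : G) : weyl (0, g) = pauliX g := by
  rw [weyl, pauliZ_zero, one_mul]

theorem star_apply_mul_apply (χ : AddChar G ℂ) (g : G) : star (χ g) * χ g = 1 := by
  have h := Complex.conj_mul' (χ g)
  rw [χ.norm_apply] at h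
  simpa using h

theorem pauliZ_neg (χ : AddChar G ℂ) : pauliZ (-χ) = star (pauliZ χ) := by
  rw [pauliZ, pauliZ, Matrix.star_eq_conjTranspose, Matrix.diagonal_conjTranspose]
  congr 1
  funext g
  rw [AddChar.neg_apply', Pi.star_apply]
  exact (eq_inv_of_mul_eq_one_left (star_apply_mul_apply χ g)).symm

/-- The phase comes from the commutation rule `Z^χ X^g = χ(g) X^g Z^χ`. -/
theorem weyl_add (m m' : AddChar G ℂ × G) :
    weyl (m + m') = m'.1 m.2 • (weyl m * weyl m') := by
  ext h' h
  simp only [Matrix.smul_apply, Matrix.mul_apply, weyl_apply, Prod.fst_add, Prod.snd_add,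
    AddChar.add_apply, mul_ite, mul_zero, Finset.sum_ite_eq', Finset.mem_univ, if_true, add_assoc]
  split_ifs with hh
  · rw [hh, AddChar.map_add_eq_mul m'.1, smul_eq_mul]
    ring
  · simp

theorem isProjRep_weyl : IsProjRep (weyl (G := G)) where
  map_zero := by rw [← Prod.mk_zero_zero, weyl_mk_zero, pauliZ_zero]
  mem_unitary m := by
    have hZ : star (pauliZ m.1) * pauliZ m.1 = 1 := by
      rw [pauliZ, Matrix.star_eq_conjTranspose, Matrix.diagonal_conjTranspose,
        Matrix.diagonal_mul_diagonal]
      simp only [Pi.star_apply, star_apply_mul_apply, Matrix.diagonal_one]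
    have hX : star (pauliX m.2) * pauliX m.2 = 1 := by
      rw [← pauliX_neg]
      ext h' h
      simp [pauliX, Matrix.mul_apply, Matrix.one_apply]
    exact mul_mem ((Unitary.mem_iff).mpr ⟨hZ, mul_eq_one_comm.mp hZ⟩)
      ((Unitary.mem_iff).mpr ⟨hX, mul_eq_one_comm.mp hX⟩)
  map_add m m' := ⟨_, star_apply_mul_apply _ _, weyl_add m m'⟩

theorem exists_not_commute_weyl {m : AddChar G ℂ × G} (hm : m ≠ 0) :
    ∃ B, weyl m * B ≠ B * weyl m := by
  by_cases hg : m.2 = 0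
  -- A nontrivial `Z^χ` is detected by `X^g` with `χ g ≠ 1`: the entries at `(g, 0)` are `χ g` and
  -- `1`.
  · obtain ⟨g, hχ⟩ := AddChar.ne_zero_iff.mp fun h : m.1 = 0 => hm (Prod.ext h hg)
    refine ⟨pauliX g, fun h => hχ ?_⟩
    simpa [Matrix.mul_apply, weyl_apply, pauliX, hg] using congrFun (congrFun h g) 0
  -- A nontrivial shift moves `|0⟩`, so it does not commute with the projection onto `|0⟩`.
  · refine ⟨Matrix.single 0 0 1, fun h => ?_⟩
    have h' := congrFun (congrFun h m.2) 0
    rw [Matrix.mul_single_apply_same, Matrix.single_mul_apply_of_ne _ _ _ _ _ hg, weyl_apply] at h'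
    have hne := (AddChar.val_isUnit m.1 m.2).ne_zero
    simp [hne] at h'

/-- For general Weyl operators negation gives the adjoint only up to a phase, so `conjAction` is
defined with `star`. For pure `Z` or pure `X` the two agree. -/
theorem opZ_neg (b : S →₀ AddChar G ℂ) : opZ (-b) = star (opZ b) :=
  (star_productOp pauliZ_zero pauliZ_neg b).symm

theorem opX_neg (a : S →₀ G) : opX (-a) = star (opX a) :=
  (star_productOp pauliX_zero pauliX_neg a).symm

theorem opZ_truncate (γ : S → AddChar G ℂ) (K : Finset S) :
    opZ (truncate γ K) = productOp weyl (truncate (fun α => (γ α, (0 : G))) K) := by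
  rw [productOp_eq_of_subset isProjRep_weyl.map_zero (support_truncate_subset _ K)]
  refine (productOp_eq_of_subset pauliZ_zero (support_truncate_subset γ K)).trans ?_
  congr 1
  refine tensorOp_congr fun α hα => ?_
  rw [truncate_apply, truncate_apply, if_pos hα, if_pos hα, weyl_mk_zero]

theorem opX_truncate (δ : S → G) (K : Finset S) :
    opX (truncate δ K) = productOp weyl (truncate (fun α => ((0 : AddChar G ℂ), δ α)) K) := by
  rw [productOp_eq_of_subset isProjRep_weyl.map_zero (support_truncate_subset _ K)]
  refine (productOp_eq_of_subset pauliX_zero (support_truncate_subset δ K)).trans ?_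
  congr 1
  refine tensorOp_congr fun α hα => ?_
  rw [truncate_apply, truncate_apply, if_pos hα, if_pos hα, weyl_zero_mk]

end Weyl

end

end KitaevCW

/-! ### The automorphisms on the `n`-cells -/

theorem proposition7 {X : Type*} [TopologicalSpace X] (E : Set X) [Topology.CWComplex E] (n : ℕ)
    (G : Type*) [AddCommGroup G] [Fintype G] :
    -- the norm limits exist
    (∀ (γ : Topology.CWComplex.cell E n → AddChar G ℂ)
        (A : KitaevCW.QuasiLocal G (Topology.CWComplex.cell E n)),
      Tendsto (fun K : Finset (Topology.CWComplex.cell E n) =>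
          KitaevCW.opZ (KitaevCW.truncate γ K) * A * KitaevCW.opZ (-KitaevCW.truncate γ K))
        atTop (𝓝 (KitaevCW.rhoZ γ A))) ∧
    (∀ (δ : Topology.CWComplex.cell E n → G)
        (A : KitaevCW.QuasiLocal G (Topology.CWComplex.cell E n)),
      Tendsto (fun K : Finset (Topology.CWComplex.cell E n) =>
          KitaevCW.opX (KitaevCW.truncate δ K) * A * KitaevCW.opX (-KitaevCW.truncate δ K))
        atTop (𝓝 (KitaevCW.rhoX δ A))) ∧
    -- they define automorphisms
    (∀ γ : Topology.CWComplex.cell E n → AddChar G ℂ,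
      KitaevCW.IsAutomorphism (KitaevCW.rhoZ γ)) ∧
    (∀ δ : Topology.CWComplex.cell E n → G, KitaevCW.IsAutomorphism (KitaevCW.rhoX δ)) ∧
    -- which are inner exactly for finite supports
    (∀ γ : Topology.CWComplex.cell E n → AddChar G ℂ,
      KitaevCW.IsInner (KitaevCW.rhoZ γ) ↔ {α | γ α ≠ 0}.Finite) ∧
    (∀ δ : Topology.CWComplex.cell E n → G,
      KitaevCW.IsInner (KitaevCW.rhoX δ) ↔ {α | δ α ≠ 0}.Finite) ∧
    -- `(γ, δ) ↦ ρ_γ ∘ ρ_δ` is a group homomorphism into the automorphism group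
    (∃ Φ : Multiplicative ((Topology.CWComplex.cell E n → AddChar G ℂ) ×
          (Topology.CWComplex.cell E n → G)) →*
        (KitaevCW.QuasiLocal G (Topology.CWComplex.cell E n) ≃⋆ₐ[ℂ]
          KitaevCW.QuasiLocal G (Topology.CWComplex.cell E n)),
      ∀ (γ : Topology.CWComplex.cell E n → AddChar G ℂ) (δ : Topology.CWComplex.cell E n → G),
        ⇑(Φ (Multiplicative.ofAdd (γ, δ))) = KitaevCW.rhoZ γ ∘ KitaevCW.rhoX δ) ∧
    -- in particular, `ρ_γ` and `ρ_δ` commute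
    (∀ (γ : Topology.CWComplex.cell E n → AddChar G ℂ) (δ : Topology.CWComplex.cell E n → G),
      KitaevCW.rhoZ γ ∘ KitaevCW.rhoX δ = KitaevCW.rhoX δ ∘ KitaevCW.rhoZ γ) := by
  obtain ⟨Ψ, hΨ⟩ := (KitaevCW.isLocalAction_conjAction
    (S := Topology.CWComplex.cell E n) (KitaevCW.isProjRep_weyl (G := G))).exists_extension
  have hlimZ (γ : Topology.CWComplex.cell E n → AddChar G ℂ)
      (A : KitaevCW.QuasiLocal G (Topology.CWComplex.cell E n)) :
      Tendsto (fun K : Finset (Topology.CWComplex.cell E n) =>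
        KitaevCW.opZ (KitaevCW.truncate γ K) * A * KitaevCW.opZ (-KitaevCW.truncate γ K))
        atTop (𝓝 (Ψ (Multiplicative.ofAdd fun α => (γ α, 0)) A)) := by
    simp only [KitaevCW.opZ_neg, KitaevCW.opZ_truncate]
    exact hΨ (fun α => (γ α, 0)) A
  have hlimX (δ : Topology.CWComplex.cell E n → G)
      (A : KitaevCW.QuasiLocal G (Topology.CWComplex.cell E n)) :
      Tendsto (fun K : Finset (Topology.CWComplex.cell E n) =>
        KitaevCW.opX (KitaevCW.truncate δ K) * A * KitaevCW.opX (-KitaevCW.truncate δ K))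
        atTop (𝓝 (Ψ (Multiplicative.ofAdd fun α => (0, δ α)) A)) := by
    simp only [KitaevCW.opX_neg, KitaevCW.opX_truncate]
    exact hΨ (fun α => (0, δ α)) A
  -- `limUnder` is meaningful only once convergence is known; uniqueness of limits then identifies
  -- it.
  have hrhoZ (γ : Topology.CWComplex.cell E n → AddChar G ℂ) :
      KitaevCW.rhoZ γ = Ψ (Multiplicative.ofAdd fun α => (γ α, 0)) :=
    funext fun A => (hlimZ γ A).limUnder_eq
  have hrhoX (δ : Topology.CWComplex.cell E n → G) :
      KitaevCW.rhoX δ = Ψ (Multiplicative.ofAdd fun α => (0, δ α)) :=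
    funext fun A => (hlimX δ A).limUnder_eq
  have hinner := KitaevCW.isInner_extension_iff KitaevCW.isProjRep_weyl hΨ
    fun _ => KitaevCW.exists_not_commute_weyl
  refine ⟨fun γ A => ?_, fun δ A => ?_, fun γ => ⟨_, fun A => congrFun (hrhoZ γ).symm A⟩,
    fun δ => ⟨_, fun A => congrFun (hrhoX δ).symm A⟩, fun γ => ?_, fun δ => ?_,
    ⟨{ toFun := fun p => Ψ (Multiplicative.ofAdd fun α => (p.toAdd.1 α, p.toAdd.2 α))
       map_one' := map_one Ψ
       map_mul' := fun p q => map_mul Ψ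
        (Multiplicative.ofAdd fun α => (p.toAdd.1 α, p.toAdd.2 α))
        (Multiplicative.ofAdd fun α => (q.toAdd.1 α, q.toAdd.2 α)) }, fun γ δ => ?_⟩,
    fun γ δ => ?_⟩
  · rw [hrhoZ]
    exact hlimZ γ A
  · rw [hrhoX]
    exact hlimX δ A
  · rw [hrhoZ, hinner]
    simp
  · rw [hrhoX, hinner]
    simp
  · have hsum : (fun α => (γ α, δ α)) = (fun α => (γ α, 0)) + fun α => (0, δ α) := by
      funext α
      simp
    funext A
    rw [hrhoZ, hrhoX, Function.comp_apply, ← StarAlgEquiv.mul_apply, ← map_mul, ← ofAdd_add, ← hsum]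
    rfl
  · funext A
    rw [hrhoZ, hrhoX, Function.comp_apply, Function.comp_apply, ← StarAlgEquiv.mul_apply,
      ← StarAlgEquiv.mul_apply, ← map_mul Ψ, ← map_mul Ψ, mul_comm (Multiplicative.ofAdd _)]
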